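/- Let $2\le k\le n-1$ be integers and $R>0$. Put $M_k=\int_0^1 \frac{t^{k-1}}{\sqrt{1-t^{2k-2}}}\,dt$, and let $f_k:[0,M_k]\to[0,1]$ be the inverse of the increasing bijection $[0,1]\to[0,M_k]$, $y\mapsto\int_0^y \frac{t^{k-1}}{\sqrt{1-t^{2k-2}}}\,dt$. Let $B=\{x''\in\mathbb R^{n-k}:\|x''\|\le M_k\}$, let $\omega(x'')=\mathrm{dist}(x'',\partial B)$ for $x''\in B$, and let the $k$-Archimedean spherical array be $$\mathscr A_k^{n-1}=\{(x'',x')\in\mathbb R^{n-k}\times\mathbb R^k:\ x''\in B,\ \|x'\|^2=[f_k(\omega(x''))]^2\}\subset\mathbb R^n .$$ Let $\mathscr A_k^{n-1}(R)=R\cdot\mathscr A_k^{n-1}$ be the scaled array whose largest spherical fiber has radius $R$. Then the $(n-1)$-volume of $\mathscr A_k^{n-1}(R)$ (its $(n-1)$-dimensional Hausdorff measure, normalized to agree with Lebesgue measure on $\mathbb R^{n-1}$) is $$\mathrm{Vol}(\mathscr A_k^{n-1}(R))=\frac{\pi^{(2n-k)/2}}{2^{n-k-2}\,(k-1)^{n-k}}\cdot\frac{\Gamma\!\left(\frac{k}{2k-2}\right)^{n-k}}{(n-k)\,\Gamma\!\left(\frac{n-k}{2}\right)\Gamma\!\left(\frac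 k2\right)\Gamma\!\left(\frac{2k-1}{2k-2}\right)^{n-k}}\;R^{n-1}.$$ -/

import Mathlib

open MeasureTheory
open scoped Pointwise

noncomputable section

namespace ArchimedeanProjection

/-- The spherical array `Ω ×_f S^{k-1}` in `ℝ^{m+k} = ℝ^m × ℝ^k` (with the Euclidean norm of the
product): over each point `x''` of the base `Ω ⊆ ℝ^m` it has a spherical fiber of radius `f x''`. -/
def sphericalArray {m k : ℕ} (Ω : Set (EuclideanSpace ℝ (Fin m)))
    (f : EuclideanSpace ℝ (Fin m) → ℝ) :
    Set (WithLp 2 (EuclideanSpace ℝ (Fin m) × EuclideanSpace ℝ (Fin k))) :=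
  {p | p.fst ∈ Ω ∧ ‖p.snd‖ ^ 2 = f p.fst ^ 2}

/-- The inverse `y ↦ ∫₀^y t^{k-1} / √(1 - t^{2k-2}) dt` of the scaling function, for `y ∈ [0, 1]`. -/
def scalingInverse (k : ℕ) (y : ℝ) : ℝ :=
  ∫ t in (0 : ℝ)..y, t ^ (k - 1) / √(1 - t ^ (2 * k - 2))

/-- `M_k = ∫₀^1 t^{k-1} / √(1 - t^{2k-2}) dt`. -/
def baseRadius (k : ℕ) : ℝ := scalingInverse k 1

/-- The codimension `k` Archimedean scaling function `f_k : [0, M_k] → [0, 1]`, the inverse of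
`scalingInverse k : [0, 1] → [0, M_k]`. (For `k ≥ 2` the latter is continuous and strictly
increasing, hence a bijection.) -/
def scalingFunction (k : ℕ) : ℝ → ℝ :=
  Function.invFunOn (scalingInverse k) (Set.Icc 0 1)

/-- The distance to the boundary of `Ω`. -/
def distToBoundary {m : ℕ} (Ω : Set (EuclideanSpace ℝ (Fin m)))
    (x : EuclideanSpace ℝ (Fin m)) : ℝ :=
  Metric.infDist x (frontier Ω)

/-- The `k`-Archimedean spherical array `𝒜_k^{n-1}` in `ℝ^n = ℝ^{n-k} × ℝ^k`: its base is the ball of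
radius `M_k`, and its warping function is `f_k ∘ ω`, with `ω` the distance to the boundary. -/
def archimedeanSphericalArray (n k : ℕ) :
    Set (WithLp 2 (EuclideanSpace ℝ (Fin (n - k)) × EuclideanSpace ℝ (Fin k))) :=
  sphericalArray (Metric.closedBall 0 (baseRadius k))
    (scalingFunction k ∘ distToBoundary (Metric.closedBall 0 (baseRadius k)))

/-- The scaled array `𝒜_k^{n-1}(R)`, whose largest spherical fiber has radius `R`. -/
def scaledArchimedeanSphericalArray (n k : ℕ) (R : ℝ) :
    Set (WithLp 2 (EuclideanSpace ℝ (Fin (n - k)) × EuclideanSpace ℝ (Fin k))) :=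
  R • archimedeanSphericalArray n k

end ArchimedeanProjection

end

namespace ArchimedeanProjection

open Module Set Filter Topology
open scoped NNReal ENNReal

/-! ### Area formula for injective immersions -/

section AreaFormula

/-! Put `m = n - k`, `j = k - 1`. Off null sets, the array is two mirror graphs over an open set of
`ℝ^m × ℝ^j`, with heights `±h`, `h² = ρ(x)² - ‖u‖²`, where `ρ` is the fiber radius. The ODE `f' =
√(1 - f^(2k-2)) / f^(k-1)`, from inverting the integral, gives `1 + ‖∇ρ‖² = ρ^(-(2k-2))`, so the
area element is `√(1 + ‖∇h‖²) = ρ^(-(k-2)) / √(ρ² - ‖u‖²)` (`one_add_norm_heightGradient_sq`).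
Integrating over the ball `‖u‖ < ρ` produces `ρ^(j-1)` times a constant, and `j - 1 = k - 2`: the
power of `ρ` cancels. This is Archimedes' principle: projection to the base multiplies volume by a
constant, and the two graphs together contribute the area of the unit `S^(k-1)`
(`setLIntegral_heightGradient`).

The volume is therefore that area times the volume of an `m`-ball of radius `M_k`, a Beta value
(`baseRadius_eq`), times `R^(n-1)`. Graph volumes come from
`euclideanHausdorffMeasure_image_eq_lintegral`. -/

theorem euclideanHausdorffMeasure_image_le_of_dist_le {α X Y : Type*} [MetricSpace X]
    [MeasurableSpace X] [BorelSpace X] [MetricSpace Y] [MeasurableSpace Y] [BorelSpace Y]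
    {u : α → X} {v : α → Y} {t : Set α} {c : ℝ≥0} (d : ℕ)
    (h : ∀ x ∈ t, ∀ y ∈ t, dist (u x) (u y) ≤ c * dist (v x) (v y)) :
    μHE[d] (u '' t) ≤ (c : ℝ≥0∞) ^ d * μHE[d] (v '' t) := by
  rcases t.eq_empty_or_nonempty with rfl | ⟨x₀, hx₀⟩
  · simp
  have : Nonempty α := ⟨x₀⟩
  have hL : LipschitzOnWith c (u ∘ Function.invFunOn v t) (v '' t) := by
    refine LipschitzOnWith.of_dist_le_mul fun p hp q hq ↦ ?_
    have h' := h _ (Function.invFunOn_mem hp) _ (Function.invFunOn_mem hq)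
    rwa [Function.invFunOn_eq hp, Function.invFunOn_eq hq] at h'
  -- `v` need not be injective: equal values of `v` force equal values of `u`, so any choice of
  -- preimages recovers `u`.
  have himage : (u ∘ Function.invFunOn v t) '' (v '' t) = u '' t := by
    refine Subset.antisymm ?_ ?_
    · rintro _ ⟨p, hp, rfl⟩
      exact ⟨_, Function.invFunOn_mem hp, rfl⟩
    · rintro _ ⟨x, hx, rfl⟩
      refine ⟨v x, ⟨x, hx, rfl⟩, ?_⟩
      have hv : v x ∈ v '' t := ⟨x, hx, rfl⟩
      have h' := h _ (Function.invFunOn_mem hv) _ hx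
      rw [Function.invFunOn_eq hv, dist_self, mul_zero] at h'
      exact dist_le_zero.1 h'
  have hH := hL.hausdorffMeasure_image_le (d := d) d.cast_nonneg
  rw [himage] at hH
  rw [Measure.euclideanHausdorffMeasure_def, Measure.euclideanHausdorffMeasure_def,
    Measure.smul_apply, Measure.smul_apply, ENNReal.smul_def, ENNReal.smul_def, smul_eq_mul,
    smul_eq_mul]
  rw [mul_left_comm]
  gcongr
  simpa using hH

variable {E F : Type*} [NormedAddCommGroup E] [InnerProductSpace ℝ E] [FiniteDimensional ℝ E]
  [MeasurableSpace E] [BorelSpace E] [NormedAddCommGroup F] [InnerProductSpace ℝ F]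
  [MeasurableSpace F] [BorelSpace F]

/-- A map that is close, in the Lipschitz sense, to an injective linear map `A` expands the
volume essentially like `A`. -/
theorem exists_approximatesLinearOn_measure_bounds (A : E →L[ℝ] F) (hA : Function.Injective A)
    {c : ℝ≥0} (hc : 1 < c) :
    ∃ δ : ℝ≥0, 0 < δ ∧ ∀ (t : Set E) (f : E → F), ApproximatesLinearOn f A t δ →
      μHE[finrank ℝ E] (f '' t) ≤
          (c : ℝ≥0∞) ^ finrank ℝ E * (ENNReal.ofReal A.normDet * volume t) ∧
        ENNReal.ofReal A.normDet * volume t ≤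
          (c : ℝ≥0∞) ^ finrank ℝ E * μHE[finrank ℝ E] (f '' t) := by
  obtain ⟨K, hK, hAK⟩ := (A : E →ₗ[ℝ] F).exists_antilipschitzWith (LinearMap.ker_eq_bot.2 hA)
  have hc0 : (0 : ℝ) < c := by exact_mod_cast zero_lt_one.trans hc
  have hc1 : (1 : ℝ) < c := by exact_mod_cast hc
  have hK0 : (0 : ℝ) < K := by exact_mod_cast hK
  -- Chosen so that `1 - δK = 1/c` exactly and `1 + δK ≤ c`; these are the two Lipschitz bounds
  -- needed.
  set δ : ℝ≥0 := (c - 1) / (c * K) with hδ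
  have hδr : (δ : ℝ) * K = (c - 1) / c := by
    rw [hδ, NNReal.coe_div, NNReal.coe_sub hc.le]
    push_cast
    field_simp
  have hδc : (δ : ℝ) * K * c = c - 1 := by rw [hδr]; field_simp
  have hδ0 : 0 < δ := div_pos (tsub_pos_of_lt hc) (mul_pos (zero_lt_one.trans hc) hK)
  refine ⟨δ, hδ0, fun t f hf ↦ ?_⟩
  have hn (x y : E) : (δ : ℝ) * ‖x - y‖ ≤ δ * K * ‖A x - A y‖ := by
    have := hAK.le_mul_dist x y
    simp only [dist_eq_norm, ContinuousLinearMap.coe_coe] at this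
    rw [mul_assoc]
    gcongr
  rw [← LinearMap.euclideanHausdorffMeasure_image_eq_normDet_mul_volume (A : E →ₗ[ℝ] F)]
  constructor
  · refine euclideanHausdorffMeasure_image_le_of_dist_le _ fun x hx y hy ↦ ?_
    have h1 := hf x hx y hy
    rw [map_sub] at h1
    have h2 := norm_le_norm_add_norm_sub (A x - A y) (f x - f y)
    rw [norm_sub_rev (A x - A y)] at h2
    have h3 : (δ : ℝ) * K ≤ c - 1 := by
      rw [← hδc]; exact le_mul_of_one_le_right (by positivity) hc1.le
    have h4 := mul_le_mul_of_nonneg_right h3 (norm_nonneg (A x - A y))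
    simp only [dist_eq_norm, ContinuousLinearMap.coe_coe]
    linarith [hn x y]
  · refine euclideanHausdorffMeasure_image_le_of_dist_le _ fun x hx y hy ↦ ?_
    have h1 := hf x hx y hy
    rw [map_sub] at h1
    simp only [dist_eq_norm, ContinuousLinearMap.coe_coe]
    have h3 : ‖A x - A y‖ * (1 - δ * K) ≤ ‖f x - f y‖ := by
      have := hn x y
      have h5 : ‖A x - A y‖ ≤ ‖f x - f y‖ + ‖f x - f y - (A x - A y)‖ := by
        have := norm_sub_le (f x - f y) (f x - f y - (A x - A y))
        rwa [sub_sub_cancel] at this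
      linarith
    have h4 := mul_le_mul_of_nonneg_left h3 hc0.le
    have : c * (‖A x - A y‖ * (1 - δ * K)) = ‖A x - A y‖ := by
      linear_combination (-‖A x - A y‖) * hδc
    linarith

/-- Area formula: the volume of the image of an injective immersion. -/
theorem euclideanHausdorffMeasure_image_eq_lintegral [FiniteDimensional ℝ F] {s : Set E}
    (hs : IsOpen s) {f : E → F} {f' : E → E →L[ℝ] F}
    (hf' : ∀ x ∈ s, HasStrictFDerivAt f (f' x) x) (hinj : InjOn f s)
    (himm : ∀ x ∈ s, Function.Injective (f' x)) :
    μHE[finrank ℝ E] (f '' s) = ∫⁻ x in s, ENNReal.ofReal (f' x).normDet := by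
  have hfc : ContinuousOn f s := fun x hx ↦
    (hf' x hx).continuousAt.continuousWithinAt
  set d := finrank ℝ E
  -- One factor `c ^ d` pays for linearizing `f` locally, the other for the variation of the
  -- Jacobian; at the end `c` tends to `1`.
  have key (c : ℝ≥0) (hc : 1 < c) :
      μHE[d] (f '' s) ≤ (c : ℝ≥0∞) ^ (2 * d) * ∫⁻ x in s, ENNReal.ofReal (f' x).normDet ∧
      ∫⁻ x in s, ENNReal.ofReal (f' x).normDet ≤ (c : ℝ≥0∞) ^ (2 * d) * μHE[d] (f '' s) := by
    have hloc (x : E) (hx : x ∈ s) : ∃ U : Set E, IsOpen U ∧ x ∈ U ∧ ∀ t ⊆ U ∩ s, MeasurableSet t →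
        μHE[d] (f '' t) ≤ (c : ℝ≥0∞) ^ (2 * d) * ∫⁻ x in t, ENNReal.ofReal (f' x).normDet ∧
        ∫⁻ x in t, ENNReal.ofReal (f' x).normDet ≤ (c : ℝ≥0∞) ^ (2 * d) * μHE[d] (f '' t) := by
      obtain ⟨δ, hδ, hb⟩ := exists_approximatesLinearOn_measure_bounds (f' x) (himm x hx) hc
      obtain ⟨V, hV, hVa⟩ := (hf' x hx).approximates_deriv_on_nhds (c := δ) (Or.inr hδ)
      obtain ⟨U, hUV, hU, hxU⟩ := mem_nhds_iff.1 hV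
      refine ⟨U, hU, hxU, fun t htU ht ↦ ?_⟩
      have hnear (y : E) (hy : y ∈ t) : ‖f' y - f' x‖ ≤ δ := by
        refine ((hf' y (htU hy).2).hasFDerivAt.sub (f' x).hasFDerivAt).le_of_lipschitzOn
          (hU.mem_nhds (htU hy).1) ?_
        exact (hVa.mono_set hUV).lipschitzOnWith
      -- Nearby Jacobians are compared by applying the same volume bounds to the linear map `f' y`
      -- on the unit ball, then cancelling the volume of the ball.
      have hdet (y : E) (hy : y ∈ t) :
          ENNReal.ofReal (f' y).normDet ≤ (c : ℝ≥0∞) ^ d * ENNReal.ofReal (f' x).normDet ∧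
          ENNReal.ofReal (f' x).normDet ≤ (c : ℝ≥0∞) ^ d * ENNReal.ofReal (f' y).normDet := by
        have happ : ApproximatesLinearOn (f' y) (f' x) (Metric.ball 0 1) δ := by
          intro p _ q _
          rw [← map_sub, ← sub_apply]
          exact (ContinuousLinearMap.le_opNorm _ _).trans (by gcongr; exact hnear y hy)
        have h := hb _ _ happ
        have hv0 : volume (Metric.ball (0 : E) 1) ≠ 0 :=
          (Metric.measure_ball_pos volume _ one_pos).ne'
        have hvt : volume (Metric.ball (0 : E) 1) ≠ ⊤ := measure_ball_lt_top.ne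
        have himg := LinearMap.euclideanHausdorffMeasure_image_eq_normDet_mul_volume
          (f' y : E →ₗ[ℝ] F) (Metric.ball 0 1)
        rw [ContinuousLinearMap.coe_coe] at himg
        rw [himg, ← mul_assoc, ← mul_assoc, ENNReal.mul_le_mul_iff_left hv0 hvt,
          ENNReal.mul_le_mul_iff_left hv0 hvt] at h
        exact h
      have h := hb t f (hVa.mono_set (htU.trans (inter_subset_left.trans hUV)))
      rw [two_mul, pow_add]
      constructor
      · refine h.1.trans ?_
        rw [mul_assoc]
        refine mul_le_mul_right ?_ _
        rw [← setLIntegral_const, ← lintegral_const_mul' _ _ (by finiteness)]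
        exact setLIntegral_mono' ht fun y hy ↦ (hdet y hy).2
      · calc ∫⁻ x in t, ENNReal.ofReal (f' x).normDet
            ≤ ∫⁻ _ in t, (c : ℝ≥0∞) ^ d * ENNReal.ofReal (f' x).normDet :=
              setLIntegral_mono' ht fun y hy ↦ (hdet y hy).1
          _ ≤ _ := by
            rw [setLIntegral_const, mul_assoc, mul_assoc]
            exact mul_le_mul_right h.2 _
    choose! U hUo hxU hU using hloc
    obtain ⟨T, hTs, hTc, hcov⟩ := TopologicalSpace.countable_cover_nhdsWithin
      (s := s) (f := U) fun x hx ↦ mem_nhdsWithin_of_mem_nhds ((hUo x hx).mem_nhds (hxU x hx))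
    rcases s.eq_empty_or_nonempty with rfl | ⟨x₀, hx₀⟩
    · simp
    have hTne : T.Nonempty := by
      obtain ⟨i, hi, -⟩ := mem_iUnion₂.1 (hcov hx₀)
      exact ⟨i, hi⟩
    obtain ⟨p, hp⟩ := hTc.exists_eq_range hTne
    have hpT (i : ℕ) : p i ∈ s := hTs (hp ▸ mem_range_self i)
    set t : ℕ → Set E := disjointed (fun i ↦ U (p i) ∩ s) with ht
    have htU (i : ℕ) : t i ⊆ U (p i) ∩ s := disjointed_subset _ _
    have htm (i : ℕ) : MeasurableSet (t i) :=
      MeasurableSet.disjointed (fun i ↦ ((hUo _ (hpT i)).inter hs).measurableSet) i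
    have hst : s = ⋃ i, t i := by
      rw [ht, iUnion_disjointed, ← iUnion_inter, right_eq_inter]
      rw [hp, biUnion_range] at hcov
      exact hcov
    have hdisj : Pairwise (Function.onFun Disjoint t) := disjoint_disjointed _
    have hI : ∫⁻ x in s, ENNReal.ofReal (f' x).normDet =
        ∑' i, ∫⁻ x in t i, ENNReal.ofReal (f' x).normDet := by
      rw [hst, lintegral_iUnion htm hdisj]
    have hM : μHE[d] (f '' s) = ∑' i, μHE[d] (f '' t i) := by
      conv_lhs => rw [hst]
      rw [image_iUnion, measure_iUnion]
      · intro i j hij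
        exact (hdisj hij).image hinj ((htU i).trans inter_subset_right)
          ((htU j).trans inter_subset_right)
      · intro i
        exact (htm i).image_of_continuousOn_injOn (hfc.mono ((htU i).trans inter_subset_right))
          (hinj.mono ((htU i).trans inter_subset_right))
    rw [hI, hM, ← ENNReal.tsum_mul_left, ← ENNReal.tsum_mul_left]
    exact ⟨ENNReal.tsum_le_tsum fun i ↦ (hU _ (hpT i) _ (htU i) (htm i)).1,
      ENNReal.tsum_le_tsum fun i ↦ (hU _ (hpT i) _ (htU i) (htm i)).2⟩
  have hlim (a : ℝ≥0∞) : Tendsto (fun c : ℝ≥0 ↦ (c : ℝ≥0∞) ^ (2 * d) * a) (𝓝[>] 1) (𝓝 a) := by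
    have h1 : Tendsto (fun c : ℝ≥0 ↦ (c : ℝ≥0∞) ^ (2 * d)) (𝓝[>] 1) (𝓝 1) := by
      have : Continuous fun c : ℝ≥0 ↦ (c : ℝ≥0∞) ^ (2 * d) := by fun_prop
      simpa using (this.tendsto 1).mono_left nhdsWithin_le_nhds
    simpa using ENNReal.Tendsto.mul_const h1 (Or.inl one_ne_zero)
  refine le_antisymm (ge_of_tendsto (hlim _) ?_) (ge_of_tendsto (hlim _) ?_)
  · filter_upwards [self_mem_nhdsWithin] with c hc using (key c hc).1
  · filter_upwards [self_mem_nhdsWithin] with c hc using (key c hc).2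

end AreaFormula

/-! ### Volume of a graph over a hyperplane -/

section Graph

variable {E F : Type*} [NormedAddCommGroup E] [InnerProductSpace ℝ E]
  [NormedAddCommGroup F] [InnerProductSpace ℝ F]

/-- The differential of `x ↦ ι x + g x • e`, where `v` is the gradient of `g`. -/
noncomputable def graphDeriv (ι : E →ₗᵢ[ℝ] F) (e : F) (v : E) : E →L[ℝ] F :=
  ι.toContinuousLinearMap + (innerSL ℝ v).smulRight e

theorem inner_graphDeriv {ι : E →ₗᵢ[ℝ] F} {e : F} (he : ‖e‖ = 1)
    (hιe : ∀ x, inner ℝ (ι x) e = 0) (v x y : E) :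
    inner ℝ (graphDeriv ι e v x) (graphDeriv ι e v y) =
      inner ℝ x y + inner ℝ v x * inner ℝ v y := by
  have h' : ∀ x, inner ℝ e (ι x) = 0 := fun x ↦ by rw [real_inner_comm]; exact hιe x
  simp [graphDeriv, inner_add_left, inner_add_right, inner_smul_left, inner_smul_right, hιe, h',
    he, mul_comm]

theorem graph_injective {ι : E →ₗᵢ[ℝ] F} {e : F} (hιe : ∀ x, inner ℝ (ι x) e = 0) (g : E → ℝ) :
    Function.Injective fun x ↦ ι x + g x • e := by
  intro x y hxy
  have h : ι (x - y) = (g y - g x) • e := by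
    rw [map_sub, sub_smul]
    have h2 : ι x + g x • e = ι y + g y • e := hxy
    rw [sub_eq_sub_iff_add_eq_add, h2, add_comm]
  have h0 : inner ℝ (ι (x - y)) (ι (x - y)) = 0 := by
    nth_rw 2 [h]
    rw [inner_smul_right, hιe, mul_zero]
  rw [inner_self_eq_zero, map_eq_zero_iff ι ι.injective, sub_eq_zero] at h0
  exact h0

theorem measurableSet_graph [FiniteDimensional ℝ E] [MeasurableSpace E]
    [BorelSpace E] [MeasurableSpace F] [BorelSpace F] {ι : E →ₗᵢ[ℝ] F} {e : F}
    (hιe : ∀ x, inner ℝ (ι x) e = 0) {s : Set E} (hs : MeasurableSet s) {g : E → ℝ}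
    (hg : ContinuousOn g s) : MeasurableSet ((fun x ↦ ι x + g x • e) '' s) :=
  hs.image_of_continuousOn_injOn (ι.continuous.continuousOn.add (hg.smul continuousOn_const))
    (graph_injective hιe g).injOn

theorem graphDeriv_injective {ι : E →ₗᵢ[ℝ] F} {e : F} (he : ‖e‖ = 1)
    (hιe : ∀ x, inner ℝ (ι x) e = 0) (v : E) : Function.Injective (graphDeriv ι e v) := by
  rw [injective_iff_map_eq_zero]
  intro x hx
  have h := inner_graphDeriv he hιe v x x
  rw [hx, inner_zero_left, real_inner_self_eq_norm_sq] at h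
  have : ‖x‖ ^ 2 ≤ 0 := by nlinarith [mul_self_nonneg (inner ℝ v x)]
  exact norm_eq_zero.1 (pow_eq_zero_iff two_ne_zero |>.1 (le_antisymm this (sq_nonneg _)))

variable [FiniteDimensional ℝ E] [FiniteDimensional ℝ F]

/-- The Gram operator is `x ↦ x + ⟪v, x⟫ v`, a rank-one perturbation of the identity with
determinant `1 + ‖v‖²`. -/
theorem normDet_graphDeriv {ι : E →ₗᵢ[ℝ] F} {e : F} (he : ‖e‖ = 1)
    (hιe : ∀ x, inner ℝ (ι x) e = 0) (v : E) :
    (graphDeriv ι e v).normDet = √(1 + ‖v‖ ^ 2) := by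
  have hdet : (LinearMap.adjoint (graphDeriv ι e v : E →ₗ[ℝ] F) ∘ₗ (graphDeriv ι e v : E →ₗ[ℝ] F)) =
      LinearMap.transvection (innerSL ℝ v : E →ₗ[ℝ] ℝ) v := by
    ext x
    refine ext_inner_right ℝ fun y ↦ ?_
    rw [LinearMap.comp_apply, LinearMap.adjoint_inner_left]
    simp only [ContinuousLinearMap.coe_coe]
    rw [inner_graphDeriv he hιe]
    simp [LinearMap.transvection.apply, inner_add_left, inner_smul_left]
  have h := LinearMap.normDet_sq (graphDeriv ι e v : E →ₗ[ℝ] F)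
  rw [hdet, LinearMap.transvection.det] at h
  rw [← Real.sqrt_sq (LinearMap.normDet_nonneg (graphDeriv ι e v : E →ₗ[ℝ] F))]
  congr 1
  simpa [real_inner_self_eq_norm_sq] using h

variable [MeasurableSpace E] [BorelSpace E] [MeasurableSpace F] [BorelSpace F]

/-- The volume of a graph. -/
theorem euclideanHausdorffMeasure_graph {ι : E →ₗᵢ[ℝ] F} {e : F} (he : ‖e‖ = 1)
    (hιe : ∀ x, inner ℝ (ι x) e = 0) {s : Set E} (hs : IsOpen s) {g : E → ℝ} {G : E → E}
    (hg : ∀ x ∈ s, HasStrictFDerivAt g (innerSL ℝ (G x)) x) :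
    μHE[finrank ℝ E] ((fun x ↦ ι x + g x • e) '' s) =
      ∫⁻ x in s, ENNReal.ofReal √(1 + ‖G x‖ ^ 2) := by
  rw [euclideanHausdorffMeasure_image_eq_lintegral (f := fun x ↦ ι x + g x • e)
    (f' := fun x ↦ graphDeriv ι e (G x)) hs
    (fun x hx ↦ ι.toContinuousLinearMap.hasStrictFDerivAt.add ((hg x hx).smul_const e))
    (graph_injective hιe g).injOn fun x _ ↦ graphDeriv_injective he hιe _]
  simp_rw [normDet_graphDeriv he hιe]

end Graph

/-! ### Beta integrals -/

section BetaIntegrals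

theorem integrable_betaPDFReal {α β : ℝ} (hα : 0 < α) (hβ : 0 < β) :
    Integrable (ProbabilityTheory.betaPDFReal α β) ∧
      ∫ t, ProbabilityTheory.betaPDFReal α β t = 1 := by
  have hnn : ∀ t, 0 ≤ ProbabilityTheory.betaPDFReal α β t := by
    intro t
    by_cases ht : 0 < t ∧ t < 1
    · exact (ProbabilityTheory.betaPDFReal_pos ht.1 ht.2 hα hβ).le
    · rw [ProbabilityTheory.betaPDFReal, if_neg ht]
  have hm := (ProbabilityTheory.stronglyMeasurable_betaPDFReal α β).aestronglyMeasurable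
    (μ := volume)
  have h1 : ∫⁻ t, ENNReal.ofReal (ProbabilityTheory.betaPDFReal α β t) = 1 :=
    ProbabilityTheory.lintegral_betaPDF_eq_one hα hβ
  constructor
  · rw [← lintegral_ofReal_ne_top_iff_integrable hm (.of_forall hnn), h1]
    exact ENNReal.one_ne_top
  · rw [integral_eq_lintegral_of_nonneg_ae (.of_forall hnn) hm, h1, ENNReal.toReal_one]

/-- Substitute `t = y ^ p` in the density of the Beta distribution with parameters `a / p` and `1 /
2`. -/
theorem integral_rpow_div_sqrt_one_sub_rpow {a p : ℝ} (ha : 0 < a) (hp : 0 < p) :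
    IntegrableOn (fun y : ℝ ↦ y ^ (a - 1) / √(1 - y ^ p)) (Ioi 0) ∧
      ∫ y in Ioi (0 : ℝ), y ^ (a - 1) / √(1 - y ^ p) =
        ProbabilityTheory.beta (a / p) (1 / 2) / p := by
  have hα : 0 < a / p := div_pos ha hp
  obtain ⟨hI, h1⟩ := integrable_betaPDFReal hα one_half_pos
  have hb0 := ProbabilityTheory.beta_pos hα one_half_pos
  set b := ProbabilityTheory.beta (a / p) (1 / 2)
  set f := ProbabilityTheory.betaPDFReal (a / p) (1 / 2) with hf
  have heq : ∀ y ∈ Ioi (0 : ℝ),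
      (b / p) • ((p * y ^ (p - 1)) • f (y ^ p)) = y ^ (a - 1) / √(1 - y ^ p) := by
    intro y (hy : 0 < y)
    by_cases hy1 : y < 1
    · have hyp : y ^ p < 1 := Real.rpow_lt_one hy.le hy1 hp
      rw [hf, ProbabilityTheory.betaPDFReal, if_pos ⟨Real.rpow_pos_of_pos hy p, hyp⟩]
      have h2 : y ^ (p - 1) * (y ^ p) ^ (a / p - 1) = y ^ (a - 1) := by
        rw [← Real.rpow_mul hy.le, ← Real.rpow_add hy]
        congr 1
        field_simp
        ring
      have h3 : (1 - y ^ p) ^ ((1 : ℝ) / 2 - 1) = (√(1 - y ^ p))⁻¹ := by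
        rw [Real.sqrt_eq_rpow, ← Real.rpow_neg (by linarith)]
        norm_num
      rw [← h2, h3]
      simp only [smul_eq_mul]
      change b / p * (p * y ^ (p - 1) * (1 / b * (y ^ p) ^ (a / p - 1) * _)) = _
      field_simp
    -- For `y ≥ 1` the root is `0`, and so is the quotient, by the convention for division by zero.
    -- Hence the half-line integral is really one over `(0, 1)`.
    · have hyp : 1 ≤ y ^ p := Real.one_le_rpow (not_lt.1 hy1) hp.le
      rw [hf, ProbabilityTheory.betaPDFReal, if_neg fun h ↦ not_lt.2 hyp h.2,
        Real.sqrt_eq_zero_of_nonpos (by linarith)]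
      simp
  have hzero : ∫ t in Ioi 0, f t = 1 := by
    rw [setIntegral_eq_integral_of_forall_compl_eq_zero, h1]
    intro t ht
    rw [hf, ProbabilityTheory.betaPDFReal, if_neg fun h ↦ ht h.1]
  constructor
  · refine IntegrableOn.congr_fun ?_ heq measurableSet_Ioi
    have := (integrableOn_Ioi_comp_rpow_iff f hp.ne').2 hI.integrableOn
    rw [abs_of_pos hp] at this
    exact this.smul (b / p)
  · rw [← setIntegral_congr_fun measurableSet_Ioi heq, integral_smul,
      integral_comp_rpow_Ioi_of_pos hp, hzero, smul_eq_mul, mul_one]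

theorem integral_pow_div_sqrt_one_sub_pow {a p : ℕ} (ha : 1 ≤ a) (hp : 1 ≤ p) :
    IntegrableOn (fun y : ℝ ↦ y ^ (a - 1) / √(1 - y ^ p)) (Ioi 0) ∧
      ∫ y in Ioi (0 : ℝ), y ^ (a - 1) / √(1 - y ^ p) =
        ProbabilityTheory.beta ((a : ℝ) / p) (1 / 2) / p := by
  have h := integral_rpow_div_sqrt_one_sub_rpow (a := a) (p := p) (by positivity) (by positivity)
  simpa only [← Nat.cast_pred ha, Real.rpow_natCast] using h

theorem integrableOn_scalingInverse_integrand {k : ℕ} (hk : 2 ≤ k) :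
    IntegrableOn (fun t : ℝ ↦ t ^ (k - 1) / √(1 - t ^ (2 * k - 2))) (Ioi 0) :=
  (integral_pow_div_sqrt_one_sub_pow (by lia) (by lia)).1

theorem baseRadius_eq {k : ℕ} (hk : 2 ≤ k) :
    baseRadius k = √Real.pi * Real.Gamma ((k : ℝ) / (2 * k - 2)) /
      (2 * ((k : ℝ) - 1) * Real.Gamma ((2 * (k : ℝ) - 1) / (2 * k - 2))) := by
  have hk' : (2 : ℝ) ≤ k := by exact_mod_cast hk
  have h := (integral_pow_div_sqrt_one_sub_pow (a := k) (p := 2 * k - 2) (by lia) (by lia)).2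
  rw [baseRadius, scalingInverse, intervalIntegral.integral_of_le zero_le_one,
    ← setIntegral_eq_of_subset_of_forall_sdiff_eq_zero measurableSet_Ioi Ioc_subset_Ioi_self, h]
  · rw [Nat.cast_sub (by lia), ProbabilityTheory.beta, Real.Gamma_one_half_eq]
    push_cast
    rw [show (k : ℝ) / (2 * k - 2) + 1 / 2 = (2 * k - 1) / (2 * k - 2) by
      have : (2 * k - 2 : ℝ) ≠ 0 := by linarith
      rw [div_add_div _ _ this two_ne_zero, div_eq_div_iff (by simpa using this) this]
      ring]
    have : (2 * k - 2 : ℝ) = 2 * (k - 1) := by ring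
    rw [div_div, this]
    ring
  · intro t ht
    have ht1 : 1 ≤ t := by
      by_contra! h1
      exact ht.2 ⟨ht.1, h1.le⟩
    rw [Real.sqrt_eq_zero_of_nonpos (by linarith [one_le_pow₀ ht1 (n := 2 * k - 2)]), div_zero]

theorem baseRadius_pos {k : ℕ} (hk : 2 ≤ k) : 0 < baseRadius k := by
  have hk' : (2 : ℝ) ≤ k := by exact_mod_cast hk
  rw [baseRadius_eq hk]
  have h1 : 0 < Real.Gamma ((k : ℝ) / (2 * k - 2)) :=
    Real.Gamma_pos_of_pos (div_pos (by linarith) (by linarith))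
  have h2 : 0 < Real.Gamma ((2 * (k : ℝ) - 1) / (2 * k - 2)) :=
    Real.Gamma_pos_of_pos (div_pos (by linarith) (by linarith))
  have h3 : (0 : ℝ) < k - 1 := by linarith
  positivity

/-- Polar coordinates reduce this to a Beta integral. The integrand vanishes outside the unit ball
by the conventions for roots and division. -/
theorem integral_one_div_sqrt_one_sub_norm_sq {j : ℕ} (hj : 1 ≤ j) :
    Integrable (fun u : EuclideanSpace ℝ (Fin j) ↦ 1 / √(1 - ‖u‖ ^ 2)) ∧
      ∫ u : EuclideanSpace ℝ (Fin j), 1 / √(1 - ‖u‖ ^ 2) =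
        √Real.pi ^ (j + 1) / Real.Gamma (((j : ℝ) + 1) / 2) := by
  have : Nonempty (Fin j) := Fin.pos_iff_nonempty.1 hj
  have hj0 : (0 : ℝ) < j := by exact_mod_cast hj
  obtain ⟨h1, h2⟩ := integral_pow_div_sqrt_one_sub_pow (a := j) (p := 2) hj (by norm_num)
  constructor
  · rw [integrable_fun_norm_addHaar volume (f := fun y : ℝ ↦ 1 / √(1 - y ^ 2))]
    simpa [div_eq_mul_inv] using h1
  · rw [integral_fun_norm_addHaar volume (fun y : ℝ ↦ 1 / √(1 - y ^ 2)), Measure.real,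
      EuclideanSpace.volume_ball]
    simp only [finrank_euclideanSpace, Fintype.card_fin, smul_eq_mul, mul_one_div, h2,
      ProbabilityTheory.beta, Real.Gamma_one_half_eq, nsmul_eq_mul]
    have hG1 := Real.Gamma_pos_of_pos (s := (j : ℝ) / 2) (by positivity)
    have hG2 := Real.Gamma_pos_of_pos (s := ((j : ℝ) + 1) / 2) (by positivity)
    rw [Real.Gamma_add_one (by positivity), ENNReal.ofReal_one, one_pow, one_mul,
      ENNReal.toReal_ofReal (by positivity)]
    push_cast
    rw [show (j : ℝ) / 2 + 1 / 2 = ((j : ℝ) + 1) / 2 by ring]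
    field_simp
    ring

theorem integral_one_div_sqrt_sq_sub_norm_sq {j : ℕ} (hj : 1 ≤ j) {r : ℝ} (hr : 0 < r) :
    Integrable (fun u : EuclideanSpace ℝ (Fin j) ↦ 1 / √(r ^ 2 - ‖u‖ ^ 2)) ∧
      ∫ u : EuclideanSpace ℝ (Fin j), 1 / √(r ^ 2 - ‖u‖ ^ 2) =
        r ^ (j - 1) * (√Real.pi ^ (j + 1) / Real.Gamma (((j : ℝ) + 1) / 2)) := by
  obtain ⟨h1, h2⟩ := integral_one_div_sqrt_one_sub_norm_sq hj
  have h : ∀ u : EuclideanSpace ℝ (Fin j),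
      1 / √(r ^ 2 - ‖r • u‖ ^ 2) = r⁻¹ * (1 / √(1 - ‖u‖ ^ 2)) := by
    intro u
    rw [norm_smul, Real.norm_of_nonneg hr.le, mul_pow, ← mul_one_sub,
      Real.sqrt_mul (sq_nonneg r), Real.sqrt_sq hr.le]
    field_simp
  constructor
  · rw [← integrable_comp_smul_iff volume (fun u : EuclideanSpace ℝ (Fin j) ↦
      1 / √(r ^ 2 - ‖u‖ ^ 2)) hr.ne']
    simp_rw [h]
    exact h1.const_mul _
  · have h3 := Measure.integral_comp_smul volume (fun u : EuclideanSpace ℝ (Fin j) ↦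
      1 / √(r ^ 2 - ‖u‖ ^ 2)) r
    simp_rw [h] at h3
    rw [integral_const_mul, h2, finrank_euclideanSpace, Fintype.card_fin,
      abs_of_pos (by positivity), smul_eq_mul] at h3
    have hG := Real.Gamma_pos_of_pos (s := ((j : ℝ) + 1) / 2) (by positivity)
    obtain ⟨i, rfl⟩ := Nat.exists_eq_add_of_le' hj
    field_simp at h3
    rw [Nat.add_sub_cancel, eq_comm, mul_div_assoc', div_eq_iff hG.ne']
    refine mul_left_cancel₀ hr.ne' ?_
    linear_combination h3

end BetaIntegrals

/-! ### The scaling function and its differential equation -/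

section ScalingFunction

variable {k : ℕ}

theorem intervalIntegrable_scalingInverse_integrand (hk : 2 ≤ k) {x y : ℝ} (hx : 0 ≤ x)
    (hy : 0 ≤ y) : IntervalIntegrable (fun t : ℝ ↦ t ^ (k - 1) / √(1 - t ^ (2 * k - 2)))
      volume x y := by
  rw [intervalIntegrable_iff]
  exact (integrableOn_scalingInverse_integrand hk).mono_set fun t ht ↦
    (le_min hx hy).trans_lt ht.1

theorem scalingInverse_integrand_pos (hk : 2 ≤ k) {t : ℝ} (ht : t ∈ Ioo (0 : ℝ) 1) :
    0 < t ^ (k - 1) / √(1 - t ^ (2 * k - 2)) := by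
  have : t ^ (2 * k - 2) < 1 := pow_lt_one₀ ht.1.le ht.2 (by lia)
  have h1 : 0 < t := ht.1
  have : 0 < 1 - t ^ (2 * k - 2) := by linarith
  positivity

theorem scalingInverse_zero : scalingInverse k 0 = 0 := intervalIntegral.integral_same

theorem strictMonoOn_scalingInverse (hk : 2 ≤ k) :
    StrictMonoOn (scalingInverse k) (Icc 0 1) := by
  intro x hx y hy hxy
  rw [← sub_pos, scalingInverse, scalingInverse, intervalIntegral.integral_interval_sub_left
    (intervalIntegrable_scalingInverse_integrand hk le_rfl hy.1)
    (intervalIntegrable_scalingInverse_integrand hk le_rfl hx.1)]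
  exact intervalIntegral.intervalIntegral_pos_of_pos_on
    (intervalIntegrable_scalingInverse_integrand hk hx.1 hy.1)
    (fun t ht ↦ scalingInverse_integrand_pos hk ⟨hx.1.trans_lt ht.1, ht.2.trans_le hy.2⟩) hxy

theorem continuousOn_scalingInverse (hk : 2 ≤ k) :
    ContinuousOn (scalingInverse k) (Icc 0 1) := by
  have h := intervalIntegral.continuousOn_primitive_interval (μ := volume) (a := 0) (b := 1)
    (f := fun t : ℝ ↦ t ^ (k - 1) / √(1 - t ^ (2 * k - 2))) (by
      rw [uIcc_of_le zero_le_one, integrableOn_Icc_iff_integrableOn_Ioc]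
      exact (integrableOn_scalingInverse_integrand hk).mono_set Ioc_subset_Ioi_self)
  rwa [uIcc_of_le zero_le_one] at h

theorem scalingInverse_image (hk : 2 ≤ k) :
    scalingInverse k '' Icc 0 1 = Icc 0 (baseRadius k) := by
  refine Subset.antisymm ?_ ?_
  · rintro _ ⟨x, hx, rfl⟩
    have hm := (strictMonoOn_scalingInverse hk).monotoneOn
    constructor
    · simpa [scalingInverse_zero] using hm (left_mem_Icc.2 zero_le_one) hx hx.1
    · exact hm hx (right_mem_Icc.2 zero_le_one) hx.2
  · simpa [scalingInverse_zero, baseRadius] using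
      intermediate_value_Icc zero_le_one (continuousOn_scalingInverse hk)

theorem scalingFunction_mem (hk : 2 ≤ k) {y : ℝ} (hy : y ∈ Icc 0 (baseRadius k)) :
    scalingFunction k y ∈ Icc (0 : ℝ) 1 :=
  Function.invFunOn_mem (by rwa [← scalingInverse_image hk] at hy)

theorem scalingInverse_scalingFunction (hk : 2 ≤ k) {y : ℝ} (hy : y ∈ Icc 0 (baseRadius k)) :
    scalingInverse k (scalingFunction k y) = y :=
  Function.invFunOn_eq (by rwa [← scalingInverse_image hk] at hy)

theorem scalingFunction_scalingInverse (hk : 2 ≤ k) {x : ℝ} (hx : x ∈ Icc (0 : ℝ) 1) :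
    scalingFunction k (scalingInverse k x) = x :=
  (strictMonoOn_scalingInverse hk).injOn.leftInvOn_invFunOn hx

theorem scalingFunction_zero (hk : 2 ≤ k) : scalingFunction k 0 = 0 := by
  simpa [scalingInverse_zero] using
    scalingFunction_scalingInverse hk (left_mem_Icc.2 (zero_le_one (α := ℝ)))

theorem scalingFunction_baseRadius (hk : 2 ≤ k) : scalingFunction k (baseRadius k) = 1 :=
  scalingFunction_scalingInverse hk (right_mem_Icc.2 (zero_le_one (α := ℝ)))

theorem scalingFunction_mem_Ioo (hk : 2 ≤ k) {y : ℝ} (hy : y ∈ Ioo 0 (baseRadius k)) :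
    scalingFunction k y ∈ Ioo (0 : ℝ) 1 := by
  have h := scalingFunction_mem hk (Ioo_subset_Icc_self hy)
  have h' := scalingInverse_scalingFunction hk (Ioo_subset_Icc_self hy)
  refine ⟨h.1.lt_of_ne fun h0 ↦ ?_, h.2.lt_of_ne fun h1 ↦ ?_⟩
  · rw [← h0, scalingInverse_zero] at h'
    exact hy.1.ne h'
  · rw [h1] at h'
    exact hy.2.ne h'.symm

/-- Compactness makes the continuous bijection `scalingInverse k` closed, so its inverse is
continuous. -/
theorem continuousOn_scalingFunction (hk : 2 ≤ k) :
    ContinuousOn (scalingFunction k) (Icc 0 (baseRadius k)) := by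
  refine continuousOn_iff_isClosed.2 fun C hC ↦ ⟨scalingInverse k '' (Icc 0 1 ∩ C), ?_, ?_⟩
  · exact ((isCompact_Icc.inter_right hC).image_of_continuousOn
      ((continuousOn_scalingInverse hk).mono inter_subset_left)).isClosed
  · ext y
    constructor
    · rintro ⟨hyC, hy⟩
      exact ⟨⟨_, ⟨scalingFunction_mem hk hy, hyC⟩, scalingInverse_scalingFunction hk hy⟩, hy⟩
    · rintro ⟨⟨x, ⟨hx, hxC⟩, rfl⟩, hy⟩
      refine ⟨?_, hy⟩
      rwa [mem_preimage, scalingFunction_scalingInverse hk hx]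

theorem hasStrictDerivAt_scalingInverse (hk : 2 ≤ k) {x : ℝ} (hx : x ∈ Ioo (0 : ℝ) 1) :
    HasStrictDerivAt (scalingInverse k) (x ^ (k - 1) / √(1 - x ^ (2 * k - 2))) x := by
  have hx1 : x ^ (2 * k - 2) < 1 := pow_lt_one₀ hx.1.le hx.2 (by lia)
  refine intervalIntegral.integral_hasStrictDerivAt_right
    (intervalIntegrable_scalingInverse_integrand hk le_rfl hx.1.le) ?_ ?_
  · exact (Measurable.stronglyMeasurable (by fun_prop)).stronglyMeasurableAtFilter
  · refine ContinuousAt.div (by fun_prop) (by fun_prop) ?_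
    exact (Real.sqrt_pos.2 (by linarith)).ne'

/-- Inverse function theorem. The open interval avoids the endpoints, where the integrand is `0` or
blows up. -/
theorem hasStrictDerivAt_scalingFunction (hk : 2 ≤ k) {y : ℝ} (hy : y ∈ Ioo 0 (baseRadius k)) :
    HasStrictDerivAt (scalingFunction k)
      (√(1 - scalingFunction k y ^ (2 * k - 2)) / scalingFunction k y ^ (k - 1)) y := by
  have hx := scalingFunction_mem_Ioo hk hy
  rw [← inv_div]
  refine HasStrictDerivAt.of_local_left_inverse
    ((continuousOn_scalingFunction hk).continuousAt (Icc_mem_nhds hy.1 hy.2))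
    (hasStrictDerivAt_scalingInverse hk hx) (scalingInverse_integrand_pos hk hx).ne' ?_
  filter_upwards [Ioo_mem_nhds hy.1 hy.2] with z hz
  exact scalingInverse_scalingFunction hk (Ioo_subset_Icc_self hz)

end ScalingFunction

/-! ### Distance to the boundary of a ball -/

section DistToBoundary

theorem distToBoundary_closedBall {m : ℕ} (hm : 1 ≤ m) {r : ℝ} (hr : 0 < r)
    {x : EuclideanSpace ℝ (Fin m)} (hx : ‖x‖ ≤ r) :
    distToBoundary (Metric.closedBall 0 r) x = r - ‖x‖ := by
  have : Nonempty (Fin m) := Fin.pos_iff_nonempty.1 hm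
  rw [distToBoundary, frontier_closedBall _ hr.ne']
  refine le_antisymm ?_ ?_
  -- The nearest boundary point lies on the ray through `x`; at the center any direction serves.
  · obtain ⟨v, hv, hxv⟩ : ∃ v : EuclideanSpace ℝ (Fin m), ‖v‖ = 1 ∧ x = ‖x‖ • v := by
      rcases eq_or_ne x 0 with rfl | hx0
      · obtain ⟨v, hv⟩ := exists_norm_eq (EuclideanSpace ℝ (Fin m)) zero_le_one
        exact ⟨v, hv, by simp⟩
      · exact ⟨‖x‖⁻¹ • x, norm_smul_inv_norm hx0, by
          rw [smul_inv_smul₀ (norm_ne_zero_iff.2 hx0)]⟩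
    have hmem : r • v ∈ Metric.sphere (0 : EuclideanSpace ℝ (Fin m)) r := by
      simp [norm_smul, hv, hr.le]
    refine (Metric.infDist_le_dist_of_mem hmem).trans_eq ?_
    nth_rw 1 [hxv]
    rw [dist_comm, dist_eq_norm, ← sub_smul, norm_smul, hv, mul_one,
      Real.norm_of_nonneg (by linarith)]
  · rw [Metric.le_infDist (NormedSpace.sphere_nonempty.2 hr.le)]
    intro y hy
    rw [dist_comm, dist_eq_norm, ← mem_sphere_zero_iff_norm.1 hy]
    exact norm_sub_norm_le y x

end DistToBoundary

/-! ### The height function and its area element -/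

section Height

/-- The radius of the fiber over a point of the base, as a function of the distance to the
center. -/
noncomputable def fiberRadius (k : ℕ) {X : Type*} [NormedAddCommGroup X] (x : X) : ℝ :=
  scalingFunction k (baseRadius k - ‖x‖)

variable {X Y : Type*} [NormedAddCommGroup X] [NormedAddCommGroup Y] {k : ℕ}

theorem continuousOn_fiberRadius (hk : 2 ≤ k) :
    ContinuousOn (fiberRadius k) {x : X | ‖x‖ ≤ baseRadius k} :=
  (continuousOn_scalingFunction hk).comp (f := fun x : X ↦ baseRadius k - ‖x‖) (by fun_prop)
    fun x (hx : ‖x‖ ≤ baseRadius k) ↦ ⟨by linarith, by linarith [norm_nonneg x]⟩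

theorem fiberRadius_mem_Ioo (hk : 2 ≤ k) {x : X} (hx0 : 0 < ‖x‖) (hx : ‖x‖ < baseRadius k) :
    fiberRadius k x ∈ Ioo (0 : ℝ) 1 :=
  scalingFunction_mem_Ioo hk ⟨by linarith, by linarith⟩

/-- The derivative of the fiber radius in the direction of the center. -/
noncomputable def fiberSlope (k : ℕ) (x : X) : ℝ :=
  √(1 - fiberRadius k x ^ (2 * k - 2)) / fiberRadius k x ^ (k - 1)

/-- The base points of the graphs making up the array. -/
def heightDomain (k : ℕ) : Set (WithLp 2 (X × Y)) :=
  {p | (0 < ‖p.fst‖ ∧ ‖p.fst‖ < baseRadius k) ∧ ‖p.snd‖ < fiberRadius k p.fst}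

/-- The modulus of the last coordinate of the points of the array. -/
noncomputable def height (k : ℕ) (p : WithLp 2 (X × Y)) : ℝ :=
  √(fiberRadius k p.fst ^ 2 - ‖p.snd‖ ^ 2)

theorem height_sq_pos {p : WithLp 2 (X × Y)} (hp : p ∈ heightDomain k) :
    0 < fiberRadius k p.fst ^ 2 - ‖p.snd‖ ^ 2 := by
  have := pow_lt_pow_left₀ hp.2 (norm_nonneg _) two_ne_zero
  linarith

theorem isOpen_heightDomain (hk : 2 ≤ k) :
    IsOpen (heightDomain k : Set (WithLp 2 (X × Y))) := by
  have hO : IsOpen {p : WithLp 2 (X × Y) | 0 < ‖p.fst‖ ∧ ‖p.fst‖ < baseRadius k} :=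
    (isOpen_lt (by fun_prop) (by fun_prop)).and (isOpen_lt (by fun_prop) (by fun_prop))
  have hc : ContinuousOn (fun p : WithLp 2 (X × Y) ↦ fiberRadius k p.fst - ‖p.snd‖)
      {p | 0 < ‖p.fst‖ ∧ ‖p.fst‖ < baseRadius k} := by
    refine ContinuousOn.sub ?_ (by fun_prop)
    exact (continuousOn_fiberRadius hk).comp (by fun_prop) fun p hp ↦ hp.2.le
  convert hc.isOpen_inter_preimage hO (isOpen_Ioi (a := 0)) using 1
  ext p
  simp [heightDomain]

theorem height_pos {p : WithLp 2 (X × Y)} (hp : p ∈ heightDomain k) : 0 < height k p :=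
  Real.sqrt_pos.2 (height_sq_pos hp)

variable [InnerProductSpace ℝ X] [InnerProductSpace ℝ Y]

theorem hasStrictFDerivAt_fiberRadius (hk : 2 ≤ k) {x : X} (hx0 : 0 < ‖x‖)
    (hx : ‖x‖ < baseRadius k) :
    HasStrictFDerivAt (fiberRadius k) (innerSL ℝ (-(fiberSlope k x / ‖x‖) • x)) x := by
  -- The norm is smooth only away from the origin, which is why the central fiber is excluded from
  -- the graphs.
  have hn : HasStrictFDerivAt (fun x : X ↦ ‖x‖) (innerSL ℝ (‖x‖⁻¹ • x)) x := by
    have h := (hasStrictFDerivAt_norm_sq x).sqrt (by positivity)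
    simp_rw [Real.sqrt_sq (norm_nonneg _)] at h
    refine h.congr_fderiv ?_
    ext y
    simp
    field_simp
  have h := (hasStrictDerivAt_scalingFunction hk (y := baseRadius k - ‖x‖)
    ⟨by linarith, by linarith⟩).comp_hasStrictFDerivAt x (hn.const_sub (baseRadius k))
  refine h.congr_fderiv ?_
  ext y
  simp [fiberSlope, fiberRadius]
  ring

/-- The gradient of `height`. -/
noncomputable def heightGradient (k : ℕ) (p : WithLp 2 (X × Y)) : WithLp 2 (X × Y) :=
  (height k p)⁻¹ • WithLp.toLp 2
    (-(fiberRadius k p.fst * fiberSlope k p.fst / ‖p.fst‖) • p.fst, -p.snd)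

theorem hasStrictFDerivAt_height (hk : 2 ≤ k) {p : WithLp 2 (X × Y)}
    (hp : p ∈ heightDomain k) :
    HasStrictFDerivAt (height k) (innerSL ℝ (heightGradient k p)) p := by
  have h1 := (hasStrictFDerivAt_fiberRadius hk hp.1.1 hp.1.2).comp p
    (WithLp.fstL 2 ℝ X Y).hasStrictFDerivAt
  have h2 := (hasStrictFDerivAt_norm_sq p.snd).comp p (WithLp.sndL 2 ℝ X Y).hasStrictFDerivAt
  have hpos := height_sq_pos hp
  have h3 := ((h1.pow 2).sub h2).sqrt hpos.ne'
  refine h3.congr_fderiv ?_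
  have hs : 0 < √(fiberRadius k p.fst ^ 2 - ‖p.snd‖ ^ 2) := Real.sqrt_pos.2 hpos
  ext v
  simp [heightGradient, height, inner_smul_left, WithLp.prod_inner_apply]
  field_simp
  ring

theorem continuousOn_height (hk : 2 ≤ k) :
    ContinuousOn (height k) (heightDomain k : Set (WithLp 2 (X × Y))) := fun _ hp ↦
  (hasStrictFDerivAt_height hk hp).continuousAt.continuousWithinAt

/-- With slope `s`, `1 + ‖∇h‖² = ρ² (1 + s²) / h²`, and the differential equation gives `1 + s² =
ρ^(-(2k-2))`. -/
theorem one_add_norm_heightGradient_sq (hk : 2 ≤ k) {p : WithLp 2 (X × Y)}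
    (hp : p ∈ heightDomain k) :
    √(1 + ‖heightGradient k p‖ ^ 2) =
      1 / fiberRadius k p.fst ^ (k - 2) * (1 / √(fiberRadius k p.fst ^ 2 - ‖p.snd‖ ^ 2)) := by
  obtain ⟨hρ0, hρ1⟩ := fiberRadius_mem_Ioo hk hp.1.1 hp.1.2
  have hpos := height_sq_pos hp
  have hsq : fiberSlope k p.fst ^ 2 =
      (1 - fiberRadius k p.fst ^ (2 * k - 2)) / (fiberRadius k p.fst ^ (k - 1)) ^ 2 := by
    rw [fiberSlope, div_pow, Real.sq_sqrt]
    linarith [pow_le_one₀ hρ0.le hρ1.le (n := 2 * k - 2)]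
  rw [Real.sqrt_eq_iff_mul_self_eq_of_pos (by positivity)]
  rw [heightGradient, norm_smul, mul_pow, WithLp.prod_norm_sq_eq_of_L2]
  simp only [WithLp.toLp_fst, WithLp.toLp_snd, norm_smul, norm_neg, mul_pow, norm_inv,
    Real.norm_eq_abs, sq_abs, inv_pow, height, abs_div, div_pow, abs_mul, abs_norm]
  rw [Real.sq_sqrt hpos.le, hsq]
  obtain ⟨i, rfl⟩ := Nat.exists_eq_add_of_le' hk
  have hx := hp.1.1
  rw [show i + 2 - 1 = i + 1 by lia, show 2 * (i + 2) - 2 = 2 * (i + 1) by lia,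
    Nat.add_sub_cancel]
  have h4 : (1 / fiberRadius (i + 2) p.fst ^ i *
      (1 / √(fiberRadius (i + 2) p.fst ^ 2 - ‖p.snd‖ ^ 2))) *
      (1 / fiberRadius (i + 2) p.fst ^ i *
      (1 / √(fiberRadius (i + 2) p.fst ^ 2 - ‖p.snd‖ ^ 2))) =
      1 / (fiberRadius (i + 2) p.fst ^ i) ^ 2 /
        (√(fiberRadius (i + 2) p.fst ^ 2 - ‖p.snd‖ ^ 2)) ^ 2 := by
    field_simp
  rw [h4, Real.sq_sqrt hpos.le]
  generalize fiberRadius (i + 2) p.fst = ρ at *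
  have := hpos.ne'
  field_simp
  ring

end Height

/-! ### Integrating the area element by Fubini -/

section HeightIntegral

theorem setLIntegral_heightGradient {m j : ℕ} (hm : 1 ≤ m) (hj : 1 ≤ j) :
    ∫⁻ p in (heightDomain (j + 1) : Set (WithLp 2 (EuclideanSpace ℝ (Fin m) ×
        EuclideanSpace ℝ (Fin j)))), ENNReal.ofReal √(1 + ‖heightGradient (j + 1) p‖ ^ 2) =
      ENNReal.ofReal (√Real.pi ^ (j + 1) / Real.Gamma (((j : ℝ) + 1) / 2)) *
        volume (Metric.ball (0 : EuclideanSpace ℝ (Fin m)) (baseRadius (j + 1))) := by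
  have : Nonempty (Fin m) := Fin.pos_iff_nonempty.1 hm
  have hk : 2 ≤ j + 1 := by lia
  set k := j + 1 with hkj
  set O : Set (EuclideanSpace ℝ (Fin m)) := {x | 0 < ‖x‖ ∧ ‖x‖ < baseRadius k} with hO
  have hOm : MeasurableSet O :=
    ((isOpen_lt (by fun_prop) (by fun_prop)).and
      (isOpen_lt (by fun_prop) (by fun_prop))).measurableSet
  set q : EuclideanSpace ℝ (Fin m) × EuclideanSpace ℝ (Fin j) → ℝ≥0∞ := fun p ↦
    ENNReal.ofReal (1 / fiberRadius k p.1 ^ (k - 2) *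
      (1 / √(fiberRadius k p.1 ^ 2 - ‖p.2‖ ^ 2))) with hq
  have hFm : AEMeasurable (fun p : EuclideanSpace ℝ (Fin m) × EuclideanSpace ℝ (Fin j) ↦
      fiberRadius k p.1) ((volume.prod volume).restrict (O ×ˢ univ)) := by
    refine ContinuousOn.aemeasurable ?_ (hOm.prod .univ)
    exact (continuousOn_fiberRadius hk).comp (by fun_prop) fun p hp ↦ hp.1.2.le
  have hqm : AEMeasurable q ((volume.prod volume).restrict (O ×ˢ univ)) := by
    simp only [hq]
    fun_prop
  have hDm : MeasurableSet (heightDomain k : Set (WithLp 2 (EuclideanSpace ℝ (Fin m) ×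
        EuclideanSpace ℝ (Fin j)))) := (isOpen_heightDomain hk).measurableSet
  have hpre : MeasurableSet ((WithLp.ofLp : WithLp 2 (EuclideanSpace ℝ (Fin m) ×
        EuclideanSpace ℝ (Fin j)) → _) ⁻¹' (O ×ˢ univ)) :=
    (WithLp.volume_preserving_ofLp _ _).measurable (hOm.prod .univ)
  have hDsub : (heightDomain k : Set (WithLp 2 (EuclideanSpace ℝ (Fin m) ×
        EuclideanSpace ℝ (Fin j)))) ⊆ WithLp.ofLp ⁻¹' (O ×ˢ univ) := fun p hp ↦ ⟨hp.1, trivial⟩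
  calc
    _ = ∫⁻ p in (heightDomain k : Set (WithLp 2 (EuclideanSpace ℝ (Fin m) ×
        EuclideanSpace ℝ (Fin j)))), q (WithLp.ofLp p) := by
      refine setLIntegral_congr_fun hDm fun p hp ↦ ?_
      simp only [one_add_norm_heightGradient_sq hk hp]
      rfl
    -- Extending to full fibers adds nothing: where `‖u‖ ≥ ρ` the root, hence the integrand, is `0`.
    -- The domain becomes a product.
    _ = ∫⁻ p in ((WithLp.ofLp : WithLp 2 (EuclideanSpace ℝ (Fin m) ×
        EuclideanSpace ℝ (Fin j)) → _) ⁻¹' (O ×ˢ univ)), q (WithLp.ofLp p) := by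
      rw [← lintegral_inter_add_sdiff _ (WithLp.ofLp ⁻¹' (O ×ˢ univ)) hDm,
        inter_eq_self_of_subset_right hDsub, setLIntegral_eq_zero (hpre.diff hDm), add_zero]
      rintro p ⟨⟨hpO, -⟩, hpD⟩
      have hle : fiberRadius k p.fst ≤ ‖p.snd‖ := not_lt.1 fun h ↦ hpD ⟨hpO, h⟩
      have h0 : 0 < fiberRadius k p.fst := (fiberRadius_mem_Ioo hk hpO.1 hpO.2).1
      have : √(fiberRadius k p.fst ^ 2 - ‖p.snd‖ ^ 2) = 0 :=
        Real.sqrt_eq_zero_of_nonpos (by linarith [pow_le_pow_left₀ h0.le hle 2])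
      change ENNReal.ofReal (1 / fiberRadius k p.fst ^ (k - 2) *
        (1 / √(fiberRadius k p.fst ^ 2 - ‖p.snd‖ ^ 2))) = 0
      simp [this]
    _ = ∫⁻ p in O ×ˢ univ, q p ∂(volume.prod volume) :=
      (WithLp.volume_preserving_ofLp _ _).setLIntegral_comp_preimage_emb
        (MeasurableEquiv.toLp 2 _).symm.measurableEmbedding q _
    _ = ∫⁻ x in O, ∫⁻ u, q (x, u) := by
      rw [← Measure.restrict_prod_eq_prod_univ] at hqm ⊢
      exact lintegral_prod _ hqm
    -- The Archimedean cancellation: the fiber integral contributes `ρ^(j-1)`, the prefactor is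
    -- `ρ^(-(k-2))`, and `k - 2 = j - 1`.
    _ = ∫⁻ x in O, ENNReal.ofReal (√Real.pi ^ (j + 1) / Real.Gamma (((j : ℝ) + 1) / 2)) := by
      refine setLIntegral_congr_fun hOm fun x hx ↦ ?_
      have h0 := (fiberRadius_mem_Ioo hk hx.1 hx.2).1
      obtain ⟨h1, h2⟩ := integral_one_div_sqrt_sq_sub_norm_sq hj h0
      simp only [hq]
      rw [← ofReal_integral_eq_lintegral_ofReal (h1.const_mul _)
        (.of_forall fun u ↦ by positivity), integral_const_mul, h2,
        show k - 2 = j - 1 by lia]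
      congr 1
      field_simp
    _ = _ := by
      rw [setLIntegral_const]
      congr 1
      have hOb : O = Metric.ball 0 (baseRadius k) \ {0} := by
        ext x
        simp [hO, and_comm]
      rw [hOb, measure_sdiff_null (measure_singleton _)]

end HeightIntegral

/-! ### Hyperplane embedding and unit normal -/

section Embedding

/-- The embedding `ℝ^j → ℝ^(j+1)` as the hyperplane on which the last coordinate vanishes. -/
noncomputable def appendZero (j : ℕ) :
    EuclideanSpace ℝ (Fin j) →ₗᵢ[ℝ] EuclideanSpace ℝ (Fin (j + 1)) where
  toFun u := WithLp.toLp 2 (Fin.snoc (α := fun _ ↦ ℝ) u 0)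
  map_add' u v := by
    ext i
    refine Fin.lastCases ?_ (fun i ↦ ?_) i <;> simp
  map_smul' c u := by
    ext i
    refine Fin.lastCases ?_ (fun i ↦ ?_) i <;> simp
  norm_map' u := by
    simp [EuclideanSpace.norm_eq, Fin.sum_univ_castSucc]

/-- The last standard basis vector of `ℝ^(j+1)`. -/
noncomputable def lastVector (j : ℕ) : EuclideanSpace ℝ (Fin (j + 1)) :=
  EuclideanSpace.single (Fin.last j) 1

theorem inner_appendZero_lastVector {j : ℕ} (u : EuclideanSpace ℝ (Fin j)) :
    inner ℝ (appendZero j u) (lastVector j) = 0 := by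
  simp [lastVector, appendZero, EuclideanSpace.inner_single_right]

theorem exists_eq_appendZero_add {j : ℕ} (z : EuclideanSpace ℝ (Fin (j + 1))) :
    ∃ u, ∃ t : ℝ, z = appendZero j u + t • lastVector j := by
  refine ⟨WithLp.toLp 2 (Fin.init (α := fun _ ↦ ℝ) z), z (Fin.last j), ?_⟩
  ext i
  refine Fin.lastCases ?_ (fun i ↦ ?_) i <;> simp [appendZero, lastVector, Fin.init]

theorem norm_appendZero_add_sq {j : ℕ} (u : EuclideanSpace ℝ (Fin j)) (t : ℝ) :
    ‖appendZero j u + t • lastVector j‖ ^ 2 = ‖u‖ ^ 2 + t ^ 2 := by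
  rw [norm_add_sq_real, inner_smul_right, inner_appendZero_lastVector, norm_smul,
    LinearIsometry.norm_map, mul_pow, Real.norm_eq_abs, sq_abs]
  simp [lastVector]

variable (m j : ℕ)

/-- The embedding of the hyperplane `ℝ^m × ℝ^j` of `ℝ^m × ℝ^(j+1)`. -/
noncomputable def baseEmbedding :
    WithLp 2 (EuclideanSpace ℝ (Fin m) × EuclideanSpace ℝ (Fin j)) →ₗᵢ[ℝ]
      WithLp 2 (EuclideanSpace ℝ (Fin m) × EuclideanSpace ℝ (Fin (j + 1))) where
  toFun p := WithLp.toLp 2 (p.fst, appendZero j p.snd)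
  map_add' p q := by
    simp
    rfl
  map_smul' c p := by
    simp
    rfl
  norm_map' p := by
    change ‖WithLp.toLp 2 (p.fst, appendZero j p.snd)‖ = ‖p‖
    rw [← sq_eq_sq₀ (norm_nonneg _) (norm_nonneg _), WithLp.prod_norm_sq_eq_of_L2,
      WithLp.prod_norm_sq_eq_of_L2]
    simp

/-- The unit normal of the hyperplane `ℝ^m × ℝ^j` of `ℝ^m × ℝ^(j+1)`. -/
noncomputable def normalVector :
    WithLp 2 (EuclideanSpace ℝ (Fin m) × EuclideanSpace ℝ (Fin (j + 1))) :=
  WithLp.toLp 2 (0, lastVector j)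

variable {m j}

theorem norm_normalVector : ‖normalVector m j‖ = 1 := by
  rw [← sq_eq_sq₀ (norm_nonneg _) zero_le_one, WithLp.prod_norm_sq_eq_of_L2]
  simp [normalVector, lastVector]

theorem inner_baseEmbedding_normalVector
    (p : WithLp 2 (EuclideanSpace ℝ (Fin m) × EuclideanSpace ℝ (Fin j))) :
    inner ℝ (baseEmbedding m j p) (normalVector m j) = 0 := by
  rw [WithLp.prod_inner_apply]
  change inner ℝ p.fst 0 + inner ℝ (appendZero j p.snd) (lastVector j) = 0
  rw [inner_zero_right, inner_appendZero_lastVector, add_zero]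

theorem baseEmbedding_add_smul_normalVector
    (p : WithLp 2 (EuclideanSpace ℝ (Fin m) × EuclideanSpace ℝ (Fin j))) (t : ℝ) :
    baseEmbedding m j p + t • normalVector m j =
      WithLp.toLp 2 (p.fst, appendZero j p.snd + t • lastVector j) := by
  change WithLp.toLp 2 (p.fst, appendZero j p.snd) + t • WithLp.toLp 2 (0, lastVector j) = _
  rw [← WithLp.toLp_smul, ← WithLp.toLp_add]
  simp

theorem finrank_withLp_prod :
    finrank ℝ (WithLp 2 (EuclideanSpace ℝ (Fin m) × EuclideanSpace ℝ (Fin j))) = m + j := by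
  rw [(WithLp.linearEquiv 2 ℝ (EuclideanSpace ℝ (Fin m) × EuclideanSpace ℝ (Fin j))).finrank_eq]
  simp

end Embedding

/-! ### Null parts of the array -/

section NullSets

variable {m j : ℕ}

theorem euclideanHausdorffMeasure_eq_zero_of_lt {X : Type*} [MetricSpace X]
    [MeasurableSpace X] [BorelSpace X] {d₁ d₂ : ℕ} (h : d₁ < d₂) {s : Set X}
    (hs : μHE[d₁] s ≠ ⊤) : μHE[d₂] s = 0 :=
  (Measure.euclideanHausdorffMeasure_zero_or_top h s).resolve_right hs

/-- The set lies in an isometric copy of a bounded part of `ℝ^m`, of finite `m`-measure, and `m < m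
+ j`. -/
theorem euclideanHausdorffMeasure_boundary {r : ℝ} (hj : 1 ≤ j) :
    μHE[m + j] {p : WithLp 2 (EuclideanSpace ℝ (Fin m) × EuclideanSpace ℝ (Fin (j + 1))) |
      ‖p.fst‖ = r ∧ p.snd = 0} = 0 := by
  have hi : Isometry fun x : EuclideanSpace ℝ (Fin m) ↦
      WithLp.toLp 2 (x, (0 : EuclideanSpace ℝ (Fin (j + 1)))) := by
    refine Isometry.of_dist_eq fun x y ↦ ?_
    rw [dist_eq_norm, dist_eq_norm, ← WithLp.toLp_sub,
      ← sq_eq_sq₀ (norm_nonneg _) (norm_nonneg _), WithLp.prod_norm_sq_eq_of_L2]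
    simp
  have himage : {p : WithLp 2 (EuclideanSpace ℝ (Fin m) × EuclideanSpace ℝ (Fin (j + 1))) |
      ‖p.fst‖ = r ∧ p.snd = 0} ⊆ (fun x : EuclideanSpace ℝ (Fin m) ↦
      WithLp.toLp 2 (x, (0 : EuclideanSpace ℝ (Fin (j + 1))))) '' Metric.closedBall 0 r := by
    rintro p ⟨h1, h2⟩
    refine ⟨p.fst, by simpa using h1.le, ?_⟩
    rw [← h2]
    rfl
  refine measure_mono_null himage ?_
  rw [hi.euclideanHausdorffMeasure_image]
  refine euclideanHausdorffMeasure_eq_zero_of_lt (d₁ := m) (by lia) ?_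
  rw [EuclideanSpace.euclideanHausdorffMeasure_eq_volume]
  exact measure_closedBall_lt_top.ne

theorem euclideanHausdorffMeasure_centralFiber {r : ℝ} (hm : 1 ≤ m) :
    μHE[m + j] {p : WithLp 2 (EuclideanSpace ℝ (Fin m) × EuclideanSpace ℝ (Fin (j + 1))) |
      p.fst = 0 ∧ ‖p.snd‖ = r} = 0 := by
  have hi : Isometry fun z : EuclideanSpace ℝ (Fin (j + 1)) ↦
      WithLp.toLp 2 ((0 : EuclideanSpace ℝ (Fin m)), z) := by
    refine Isometry.of_dist_eq fun x y ↦ ?_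
    rw [dist_eq_norm, dist_eq_norm, ← WithLp.toLp_sub,
      ← sq_eq_sq₀ (norm_nonneg _) (norm_nonneg _), WithLp.prod_norm_sq_eq_of_L2]
    simp
  have himage : {p : WithLp 2 (EuclideanSpace ℝ (Fin m) × EuclideanSpace ℝ (Fin (j + 1))) |
      p.fst = 0 ∧ ‖p.snd‖ = r} ⊆ (fun z : EuclideanSpace ℝ (Fin (j + 1)) ↦
      WithLp.toLp 2 ((0 : EuclideanSpace ℝ (Fin m)), z)) '' Metric.sphere 0 r := by
    rintro p ⟨h1, h2⟩
    refine ⟨p.snd, by simpa using h2, ?_⟩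
    rw [← h1]
    rfl
  refine measure_mono_null himage ?_
  rw [hi.euclideanHausdorffMeasure_image]
  have h0 : μHE[j + 1] (Metric.sphere (0 : EuclideanSpace ℝ (Fin (j + 1))) r) = 0 := by
    rw [EuclideanSpace.euclideanHausdorffMeasure_eq_volume]
    exact Measure.addHaar_sphere _ _ _
  -- For `m = 1` the dimension is exactly `j + 1`, in which the sphere is Lebesgue null; for larger
  -- `m` it exceeds `j + 1`.
  rcases hm.eq_or_lt with rfl | hm
  · rwa [Nat.add_comm 1 j]
  · refine euclideanHausdorffMeasure_eq_zero_of_lt (d₁ := j + 1) (by lia) ?_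
    rw [h0]
    exact ENNReal.zero_ne_top

/-- Inside the hyperplane the measure is Lebesgue measure, and each slice over the base is contained
in a sphere of `ℝ^j`, so Fubini applies. -/
theorem euclideanHausdorffMeasure_equator {k : ℕ} (hk : 2 ≤ k) (hj : 1 ≤ j) :
    μHE[m + j] (baseEmbedding m j '' {p | ‖p.fst‖ ≤ baseRadius k ∧
      ‖p.snd‖ = fiberRadius k p.fst}) = 0 := by
  have : Nonempty (Fin j) := Fin.pos_iff_nonempty.1 hj
  rw [(baseEmbedding m j).isometry.euclideanHausdorffMeasure_image, ← finrank_withLp_prod,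
    InnerProductSpace.euclideanHausdorffMeasure_eq_volume]
  set N : Set (EuclideanSpace ℝ (Fin m) × EuclideanSpace ℝ (Fin j)) :=
    {p | ‖p.1‖ ≤ baseRadius k ∧ ‖p.2‖ = fiberRadius k p.1} with hN
  have hNm : MeasurableSet N := by
    have hK : IsClosed {p : EuclideanSpace ℝ (Fin m) × EuclideanSpace ℝ (Fin j) |
        ‖p.1‖ ≤ baseRadius k} := isClosed_le (by fun_prop) (by fun_prop)
    have hc : ContinuousOn (fun p : EuclideanSpace ℝ (Fin m) × EuclideanSpace ℝ (Fin j) ↦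
        ‖p.2‖ - fiberRadius k p.1) {p | ‖p.1‖ ≤ baseRadius k} := by
      refine ContinuousOn.sub (by fun_prop) ?_
      exact (continuousOn_fiberRadius hk).comp (by fun_prop) fun p hp ↦ hp
    convert (hc.preimage_isClosed_of_isClosed hK (isClosed_singleton (x := 0))).measurableSet
      using 1
    ext p
    simp [hN, sub_eq_zero]
  have h0 : (volume.prod volume) N = 0 := by
    refine Measure.measure_prod_null_of_ae_null hNm (.of_forall fun x ↦ ?_)
    exact measure_mono_null (fun u hu ↦ mem_sphere_zero_iff_norm.2 hu.2)
      (Measure.addHaar_sphere volume 0 (fiberRadius k x))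
  rw [← Measure.volume_eq_prod, ← (WithLp.volume_preserving_ofLp (EuclideanSpace ℝ (Fin m))
    (EuclideanSpace ℝ (Fin j))).measure_preimage hNm.nullMeasurableSet] at h0
  exact h0

end NullSets

/-! ### Assembling the array from two graphs -/

section Volume

variable {m j : ℕ}

theorem mem_sphericalArray_iff (hm : 1 ≤ m) {k l : ℕ} (hk : 2 ≤ k)
    {p : WithLp 2 (EuclideanSpace ℝ (Fin m) × EuclideanSpace ℝ (Fin l))} :
    p ∈ sphericalArray (Metric.closedBall 0 (baseRadius k))
        (scalingFunction k ∘ distToBoundary (Metric.closedBall 0 (baseRadius k))) ↔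
      ‖p.fst‖ ≤ baseRadius k ∧ ‖p.snd‖ ^ 2 = fiberRadius k p.fst ^ 2 := by
  rw [sphericalArray, mem_ofPred_eq, mem_closedBall_zero_iff]
  refine and_congr_right fun h ↦ ?_
  rw [Function.comp_apply, distToBoundary_closedBall hm (baseRadius_pos hk) h, fiberRadius]

/-- The part of the array lying on the side of `c • normalVector m j`, for `c = ±1`. -/
noncomputable def heightGraph (m j : ℕ) (c : ℝ) :
    Set (WithLp 2 (EuclideanSpace ℝ (Fin m) × EuclideanSpace ℝ (Fin (j + 1)))) :=
  (fun p ↦ baseEmbedding m j p + height (j + 1) p • c • normalVector m j) ''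
    heightDomain (j + 1)

theorem euclideanHausdorffMeasure_heightGraph (hm : 1 ≤ m) (hj : 1 ≤ j) {c : ℝ} (hc : |c| = 1) :
    μHE[m + j] (heightGraph m j c) =
      ENNReal.ofReal (√Real.pi ^ (j + 1) / Real.Gamma (((j : ℝ) + 1) / 2)) *
        volume (Metric.ball (0 : EuclideanSpace ℝ (Fin m)) (baseRadius (j + 1))) := by
  have h := euclideanHausdorffMeasure_graph (ι := baseEmbedding m j) (e := c • normalVector m j)
    ?_ ?_ (isOpen_heightDomain (by lia)) fun p hp ↦ hasStrictFDerivAt_height (k := j + 1) (by lia) hp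
  · rwa [finrank_withLp_prod, setLIntegral_heightGradient hm hj] at h
  · rw [norm_smul, norm_normalVector, mul_one, Real.norm_eq_abs, hc]
  · intro p
    rw [inner_smul_right, inner_baseEmbedding_normalVector, mul_zero]

theorem measurableSet_heightGraph (hj : 1 ≤ j) (c : ℝ) : MeasurableSet (heightGraph m j c) := by
  refine measurableSet_graph (fun p ↦ ?_) (isOpen_heightDomain (by lia)).measurableSet
    (continuousOn_height (by lia))
  rw [inner_smul_right, inner_baseEmbedding_normalVector, mul_zero]

theorem heightGraph_eq (c : ℝ) : heightGraph m j c =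
    {q | ∃ x u, WithLp.toLp 2 (x, u) ∈ heightDomain (j + 1) ∧
      q = WithLp.toLp 2 (x, appendZero j u +
        (height (j + 1) (WithLp.toLp 2 (x, u)) * c) • lastVector j)} := by
  ext q
  simp only [heightGraph, smul_smul, baseEmbedding_add_smul_normalVector]
  constructor
  · rintro ⟨p, hp, rfl⟩
    exact ⟨p.fst, p.snd, hp, rfl⟩
  · rintro ⟨x, u, hp, rfl⟩
    exact ⟨_, hp, rfl⟩

/-- The normal component has opposite strict signs on the two graphs. -/
theorem disjoint_heightGraph : Disjoint (heightGraph m j 1) (heightGraph m j (-1)) := by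
  have h (c : ℝ) {q} (hq : q ∈ heightGraph m j c) :
      ∃ t > 0, inner ℝ (normalVector m j) q = t * c := by
    obtain ⟨p, hp, rfl⟩ := hq
    refine ⟨height (j + 1) p, height_pos hp, ?_⟩
    rw [inner_add_right, real_inner_comm, inner_baseEmbedding_normalVector, smul_smul,
      inner_smul_right, real_inner_self_eq_norm_sq, norm_normalVector]
    ring
  refine disjoint_left.2 fun q h1 h2 ↦ ?_
  obtain ⟨t, ht, htq⟩ := h 1 h1
  obtain ⟨t', ht', htq'⟩ := h (-1) h2
  linarith

theorem euclideanHausdorffMeasure_sphericalArray (hm : 1 ≤ m) (hj : 1 ≤ j) :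
    μHE[m + j] (sphericalArray (m := m) (k := j + 1) (Metric.closedBall 0 (baseRadius (j + 1)))
        (scalingFunction (j + 1) ∘
          distToBoundary (Metric.closedBall 0 (baseRadius (j + 1))))) =
      2 * (ENNReal.ofReal (√Real.pi ^ (j + 1) / Real.Gamma (((j : ℝ) + 1) / 2)) *
        volume (Metric.ball (0 : EuclideanSpace ℝ (Fin m)) (baseRadius (j + 1)))) := by
  have hk : 2 ≤ j + 1 := by lia
  set A := sphericalArray (m := m) (k := j + 1) (Metric.closedBall 0 (baseRadius (j + 1)))
        (scalingFunction (j + 1) ∘ distToBoundary (Metric.closedBall 0 (baseRadius (j + 1))))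
    with hA
  have hU : μHE[m + j] (heightGraph m j 1 ∪ heightGraph m j (-1)) =
      2 * (ENNReal.ofReal (√Real.pi ^ (j + 1) / Real.Gamma (((j : ℝ) + 1) / 2)) *
        volume (Metric.ball (0 : EuclideanSpace ℝ (Fin m)) (baseRadius (j + 1)))) := by
    rw [measure_union disjoint_heightGraph (measurableSet_heightGraph hj _),
      euclideanHausdorffMeasure_heightGraph hm hj (by simp),
      euclideanHausdorffMeasure_heightGraph hm hj (by simp), two_mul]
  rw [← hU]
  have hsub (c : ℝ) (hc : c ^ 2 = 1) : heightGraph m j c ⊆ A := by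
    rw [heightGraph_eq]
    rintro _ ⟨x, u, hp, rfl⟩
    rw [hA, mem_sphericalArray_iff hm hk]
    refine ⟨hp.1.2.le, ?_⟩
    simp only [WithLp.toLp_snd, WithLp.toLp_fst]
    rw [norm_appendZero_add_sq, mul_pow, hc, mul_one, height, Real.sq_sqrt (height_sq_pos hp).le]
    simp
  refine le_antisymm ?_ (measure_mono (union_subset (hsub 1 (by simp)) (hsub (-1) (by simp))))
  -- What the graphs miss: the base boundary, where fibers collapse; the central fiber; and the
  -- equator, where the last coordinate vanishes.
  set N₁ : Set (WithLp 2 (EuclideanSpace ℝ (Fin m) × EuclideanSpace ℝ (Fin (j + 1)))) :=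
    {p | ‖p.fst‖ = baseRadius (j + 1) ∧ p.snd = 0}
  set N₂ : Set (WithLp 2 (EuclideanSpace ℝ (Fin m) × EuclideanSpace ℝ (Fin (j + 1)))) :=
    {p | p.fst = 0 ∧ ‖p.snd‖ = 1}
  set N₃ : Set (WithLp 2 (EuclideanSpace ℝ (Fin m) × EuclideanSpace ℝ (Fin (j + 1)))) :=
    baseEmbedding m j '' {p | ‖p.fst‖ ≤ baseRadius (j + 1) ∧ ‖p.snd‖ = fiberRadius (j + 1) p.fst}
  have hN : μHE[m + j] (N₁ ∪ N₂ ∪ N₃) = 0 :=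
    measure_union_null (measure_union_null (euclideanHausdorffMeasure_boundary hj)
      (euclideanHausdorffMeasure_centralFiber hm)) (euclideanHausdorffMeasure_equator hk hj)
  have hcover : A ⊆ (heightGraph m j 1 ∪ heightGraph m j (-1)) ∪ (N₁ ∪ N₂ ∪ N₃) := by
    intro q hq
    obtain ⟨hqM, hqn⟩ := (mem_sphericalArray_iff hm hk).1 hq
    rcases hqM.eq_or_lt with h1 | hlt
    · right; left; left
      refine ⟨h1, ?_⟩
      rw [fiberRadius, h1, sub_self, scalingFunction_zero hk] at hqn
      simpa using hqn
    rcases (norm_nonneg q.fst).eq_or_lt with h0 | h0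
    · right; left; right
      refine ⟨norm_eq_zero.1 h0.symm, ?_⟩
      rw [fiberRadius, ← h0, sub_zero, scalingFunction_baseRadius hk] at hqn
      exact (sq_eq_sq₀ (norm_nonneg _) zero_le_one).1 hqn
    obtain ⟨u, t, hz⟩ := exists_eq_appendZero_add q.snd
    have hq' : q = WithLp.toLp 2 (q.fst, appendZero j u + t • lastVector j) := by
      rw [← hz]; rfl
    rw [hz, norm_appendZero_add_sq] at hqn
    have hF := (fiberRadius_mem_Ioo hk h0 hlt).1
    rcases eq_or_ne t 0 with rfl | ht
    · right; right
      refine ⟨WithLp.toLp 2 (q.fst, u), ⟨hqM, ?_⟩, ?_⟩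
      · exact (sq_eq_sq₀ (norm_nonneg _) hF.le).1 (by simpa using hqn)
      · rw [hq', zero_smul, add_zero]
        rfl
    · left
      have hu : WithLp.toLp 2 (q.fst, u) ∈ heightDomain (j + 1) := by
        refine ⟨⟨h0, hlt⟩, lt_of_pow_lt_pow_left₀ 2 hF.le ?_⟩
        have : 0 < t ^ 2 := by positivity
        change ‖u‖ ^ 2 < fiberRadius (j + 1) q.fst ^ 2
        linarith
      have hh : height (j + 1) (WithLp.toLp 2 (q.fst, u)) = |t| := by
        change √(fiberRadius (j + 1) q.fst ^ 2 - ‖u‖ ^ 2) = |t|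
        rw [← hqn, add_sub_cancel_left, Real.sqrt_sq_eq_abs]
      rw [heightGraph_eq, heightGraph_eq]
      rcases ht.lt_or_gt with ht | ht
      · right
        refine ⟨q.fst, u, hu, ?_⟩
        rw [hh, abs_of_neg ht, mul_neg_one, neg_neg]
        exact hq'
      · left
        refine ⟨q.fst, u, hu, ?_⟩
        rw [hh, abs_of_pos ht, mul_one]
        exact hq'
  calc μHE[m + j] A ≤ μHE[m + j] (heightGraph m j 1 ∪ heightGraph m j (-1)) +
        μHE[m + j] (N₁ ∪ N₂ ∪ N₃) := (measure_mono hcover).trans (measure_union_le _ _)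
    _ = _ := by rw [hN, add_zero]

end Volume

theorem volume_formula {m j : ℕ} (hm : 1 ≤ m) (hj : 1 ≤ j) (R : ℝ) :
    R ^ (m + j) * (2 * (√Real.pi ^ (j + 1) / Real.Gamma (((j : ℝ) + 1) / 2) *
      (baseRadius (j + 1) ^ m * (√Real.pi ^ m / Real.Gamma ((m : ℝ) / 2 + 1))))) =
      Real.pi ^ ((2 * ((m + j + 1 : ℕ) : ℝ) - (j + 1 : ℕ)) / 2) /
          ((2 : ℝ) ^ (((m + j + 1 : ℕ) : ℤ) - (j + 1 : ℕ) - 2) * (((j + 1 : ℕ) : ℝ) - 1) ^ m) *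
        (Real.Gamma (((j + 1 : ℕ) : ℝ) / (2 * (j + 1 : ℕ) - 2)) ^ m /
          ((((m + j + 1 : ℕ) : ℝ) - (j + 1 : ℕ)) *
            Real.Gamma ((((m + j + 1 : ℕ) : ℝ) - (j + 1 : ℕ)) / 2) *
            Real.Gamma (((j + 1 : ℕ) : ℝ) / 2) *
            Real.Gamma ((2 * ((j + 1 : ℕ) : ℝ) - 1) / (2 * (j + 1 : ℕ) - 2)) ^ m)) *
        R ^ (m + j) := by
  have hj0 : (0 : ℝ) < j := by exact_mod_cast hj
  have hm0 : (0 : ℝ) < m := by exact_mod_cast hm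
  have hpi : Real.pi ^ ((2 * ((m + j + 1 : ℕ) : ℝ) - (j + 1 : ℕ)) / 2) =
      √Real.pi ^ (j + 1) * √Real.pi ^ m * √Real.pi ^ m := by
    rw [← pow_add, ← pow_add, ← Real.rpow_natCast, Real.sqrt_eq_rpow, ← Real.rpow_mul Real.pi_nonneg]
    congr 1
    push_cast
    ring
  -- The exponent `m - 2` is `-1` when `m = 1`, hence an integer power.
  have h2 : (2 : ℝ) ^ (((m + j + 1 : ℕ) : ℤ) - (j + 1 : ℕ) - 2) = 2 ^ m / 4 := by
    rw [show ((m + j + 1 : ℕ) : ℤ) - (j + 1 : ℕ) - 2 = (m : ℤ) - 2 by push_cast; ring,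
      zpow_sub₀ two_ne_zero, zpow_natCast]
    norm_num
  have hmcast : ((m + j + 1 : ℕ) : ℝ) - (j + 1 : ℕ) = m := by push_cast; ring
  have hG1 := Real.Gamma_pos_of_pos (s := (m : ℝ) / 2) (by positivity)
  have hG2 := Real.Gamma_pos_of_pos (s := ((j : ℝ) + 1) / 2) (by positivity)
  have hG3 := Real.Gamma_pos_of_pos
    (s := (2 * ((j + 1 : ℕ) : ℝ) - 1) / (2 * (j + 1 : ℕ) - 2)) (by
      push_cast
      exact div_pos (by linarith) (by linarith))
  have hkcast : ((j + 1 : ℕ) : ℝ) - 1 = j := by push_cast; ring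
  -- `Γ(m/2 + 1) = (m/2) Γ(m/2)` supplies the factor `m` in the denominator and one of the two
  -- factors `2` that make up the `4`.
  rw [baseRadius_eq (by lia), hpi, h2, hmcast, hkcast, Real.Gamma_add_one (by positivity)]
  generalize Real.Gamma ((2 * ((j + 1 : ℕ) : ℝ) - 1) / (2 * (j + 1 : ℕ) - 2)) = G3 at *
  generalize Real.Gamma (((j + 1 : ℕ) : ℝ) / (2 * (j + 1 : ℕ) - 2)) = G4 at *
  rw [show ((j + 1 : ℕ) : ℝ) / 2 = ((j : ℝ) + 1) / 2 by push_cast; rfl]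
  rw [div_pow, mul_pow, mul_pow, mul_pow]
  field_simp
  ring

end ArchimedeanProjection

/-- `μHE[n - 1]` is the `(n-1)`-dimensional Hausdorff measure, normalized to agree with Lebesgue
measure on `ℝ^{n-1}`, that is, the `(n-1)`-dimensional volume. -/
theorem theorem4 (n k : ℕ) (hk : 2 ≤ k) (hkn : k < n) (R : ℝ) (hR : 0 < R) :
    μHE[n - 1] (ArchimedeanProjection.scaledArchimedeanSphericalArray n k R) =
      ENNReal.ofReal
        (Real.pi ^ ((2 * (n : ℝ) - k) / 2) /
            ((2 : ℝ) ^ ((n : ℤ) - k - 2) * ((k : ℝ) - 1) ^ (n - k)) *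
          (Real.Gamma ((k : ℝ) / (2 * k - 2)) ^ (n - k) /
            (((n : ℝ) - k) * Real.Gamma (((n : ℝ) - k) / 2) * Real.Gamma ((k : ℝ) / 2) *
              Real.Gamma ((2 * (k : ℝ) - 1) / (2 * k - 2)) ^ (n - k))) *
          R ^ (n - 1)) := by
  obtain ⟨j, rfl⟩ := Nat.exists_eq_add_of_le' (show 1 ≤ k by lia)
  obtain ⟨m, hm⟩ : ∃ m, n - (j + 1) = m := ⟨_, rfl⟩
  have hn : n = m + j + 1 := by lia
  have hm1 : 1 ≤ m := by lia
  have hj1 : 1 ≤ j := by lia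
  have hA : μHE[n - 1] (ArchimedeanProjection.archimedeanSphericalArray n (j + 1)) =
      2 * (ENNReal.ofReal (√Real.pi ^ (j + 1) / Real.Gamma (((j : ℝ) + 1) / 2)) *
        volume (Metric.ball (0 : EuclideanSpace ℝ (Fin m))
          (ArchimedeanProjection.baseRadius (j + 1)))) := by
    -- The ambient type depends on `n - (j + 1)`, so `m` is eliminated in its favor here, not the
    -- reverse.
    rw [show n - 1 = n - (j + 1) + j by lia]
    subst hm
    exact ArchimedeanProjection.euclideanHausdorffMeasure_sphericalArray hm1 hj1
  have : Nonempty (Fin m) := Fin.pos_iff_nonempty.1 hm1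
  have hM := ArchimedeanProjection.baseRadius_pos hk
  have hG1 := Real.Gamma_pos_of_pos (s := (m : ℝ) / 2 + 1) (by positivity)
  have hG2 := Real.Gamma_pos_of_pos (s := ((j : ℝ) + 1) / 2) (by positivity)
  rw [ArchimedeanProjection.scaledArchimedeanSphericalArray,
    Measure.euclideanHausdorffMeasure_smul₀ _ hR.ne', hA, EuclideanSpace.volume_ball, hm]
  subst hn
  rw [Nat.add_sub_cancel, Fintype.card_fin, ← ArchimedeanProjection.volume_formula hm1 hj1,
    ENNReal.ofReal_mul (by positivity), ENNReal.ofReal_mul (by positivity),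
    ENNReal.ofReal_mul (by positivity), ENNReal.ofReal_mul (by positivity),
    ENNReal.ofReal_pow hM.le, ENNReal.ofReal_pow hR.le, ENNReal.smul_def, smul_eq_mul,
    ENNReal.coe_pow, ← Real.enorm_of_nonneg hR.le, ENNReal.ofReal_ofNat]
  rfl
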